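/- Let $p$ be a prime, $m\ge 2$ an even integer, $q=p^m$, and let $(k,q)$ be a semiprimitive pair, i.e. either $k=2$ and $q\equiv 1 \pmod 4$, or $k>2$, $k\mid p^j+1$ for some $j\mid \frac m2$, and $k\neq p^{m/2}+1$. Let $t$ be the least positive integer with $k\mid p^t+1$, and put $$n=\frac{q-1}{k},\qquad s=\frac{m}{2t},\qquad \sigma=(-1)^{s+1},\qquad \lambda_1=\frac{\sigma(k-1)p^{m/2}-1}{k},\qquad \lambda_2=-\frac{\sigma p^{m/2}+1}{k}.$$ Let $R_k=\{x^k : x\in\mathbb F_q^*\}$. Let $\Gamma=\Gamma(k,q)$ be the Cayley graph with vertex set $\mathbb F_q$ and an arrow from $u$ to $v$ if and only if $v-u\in R_k$; let $\bar\Gamma$ be its (loopless) complement; and let $\Gamma^+=\Gamma^+(k,q)$ be the Cayley sum graph with vertex set $\mathbb F_q$ and an arrow from $u$ to $v$ if and only if $u+v\in R_k$ (loops allowed). Write $Spec$ for the multiset of eigenvalues of the $0/1$ adjacency matrix; $\{[\mu_0]^{m_0},\dots,[\mu_r]^{m_r}\}$ means that the $\mu_i$ are the pairwise distinct eigenvalues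 and $m_i$ is the multiplicity of $\mu_i$. Then all eigenvalues of $\Gamma$, $\bar\Gamma$ and $\Gamma^+$ are integers, and $$Spec(\Gamma)=\{[n]^1,[\lambda_1]^n,[\lambda_2]^{(k-1)n}\},\qquad Spec(\bar\Gamma)=\{[(k-1)n]^1,[(k-1)\lambda_2]^n,[-1-\lambda_2]^{(k-1)n}\}.$$ Furthermore, $Spec(\Gamma^+)=Spec(\Gamma)$ if $q$ is even, while if $q$ is odd then $n$ is even and $$Spec(\Gamma^+)=\{[n]^1,[\lambda_1]^{n/2},[-\lambda_1]^{n/2},[\lambda_2]^{(k-1)n/2},[-\lambda_2]^{(k-1)n/2}\}.$$ -/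

import Mathlib

/-- The directed Cayley graph `X(G, S)`: there is an arrow from `u` to `v` iff `v - u ∈ S`. -/
def cayleyDigraph {G : Type*} [AddGroup G] (S : Set G) : Digraph G where
  Adj u v := v - u ∈ S

/-- The Cayley sum graph `X⁺(G, S)`: there is an arrow from `u` to `v` iff `u + v ∈ S`.
Loops (at the `x` with `x + x ∈ S`) are allowed. -/
def cayleySumDigraph {G : Type*} [AddGroup G] (S : Set G) : Digraph G where
  Adj u v := u + v ∈ S

/-- The set `R_k = {x ^ k : x ∈ F, x ≠ 0}` of nonzero `k`-th powers of a field `F`. -/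
def powerSet (F : Type*) [Field F] (k : ℕ) : Set F :=
  {y | ∃ x : F, x ≠ 0 ∧ x ^ k = y}

/-- The generalized Paley graph `Γ(k, q)`, on a finite field `F` with `q` elements. -/
def paleyGraph (F : Type*) [Field F] (k : ℕ) : Digraph F :=
  cayleyDigraph (powerSet F k)

/-- The generalized Paley sum graph `Γ⁺(k, q)`, on a finite field `F` with `q` elements. -/
def paleySumGraph (F : Type*) [Field F] (k : ℕ) : Digraph F :=
  cayleySumDigraph (powerSet F k)

/-- The loopless complement of a graph: distinct vertices are adjacent iff they are not adjacent
in the given graph. (The Boolean complement of `Digraph` would put a loop at every vertex.) -/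
def looplessCompl {V : Type*} (D : Digraph V) : Digraph V where
  Adj u v := u ≠ v ∧ ¬ D.Adj u v

open Classical in
/-- The complex adjacency matrix; a loop at `v` gives the diagonal entry `1`. -/
noncomputable def digraphAdjMatrix {V : Type*} (D : Digraph V) : Matrix V V ℂ :=
  Matrix.of fun u v => if D.Adj u v then 1 else 0

open Classical in
/-- The spectrum of a finite graph: the multiset of the complex eigenvalues of its adjacency
matrix, with (algebraic) multiplicities. -/
noncomputable def graphSpectrum {V : Type*} [Fintype V] (D : Digraph V) : Multiset ℂ :=
  (digraphAdjMatrix D).charpoly.roots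

/-- `HasGraphSpectrum D [(l₀, m₀), …, (lᵣ, mᵣ)]` says `Spec(D) = {[l₀]^m₀, …, [lᵣ]^mᵣ}`:
the numbers `l₀, …, lᵣ` are pairwise distinct, and the spectrum consists of each `lᵢ` with
multiplicity `mᵢ`, and nothing else. -/
def HasGraphSpectrum {V : Type*} [Fintype V] (D : Digraph V) (L : List (ℂ × ℕ)) : Prop :=
  (L.map Prod.fst).Nodup ∧
    graphSpectrum D = (L.map fun a => Multiset.replicate a.2 a.1).sum

/-- A graph is integral if all its eigenvalues are integers. -/
def IsIntegralGraph {V : Type*} [Fintype V] (D : Digraph V) : Prop :=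
  ∀ z ∈ graphSpectrum D, ∃ a : ℤ, z = (a : ℂ)

/-- `(k, p ^ m)` is a semiprimitive pair: either `k = 2` and `p ^ m ≡ 1 (mod 4)`, or `k > 2`,
`k ∣ p ^ t + 1` for some `t` such that `m` is even and `t ∣ m / 2`, and `k ≠ p ^ (m / 2) + 1`. -/
def IsSemiprimitivePair (k p m : ℕ) : Prop :=
  (k = 2 ∧ p ^ m ≡ 1 [MOD 4]) ∨
    (2 < k ∧ (∃ t : ℕ, Even m ∧ t ∣ m / 2 ∧ k ∣ p ^ t + 1) ∧ k ≠ p ^ (m / 2) + 1)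

/-- The least positive integer `t` such that `k ∣ p ^ t + 1`. -/
noncomputable def semiprimitiveExponent (k p : ℕ) : ℕ :=
  sInf {t : ℕ | 0 < t ∧ k ∣ p ^ t + 1}

/-- The sign `σ = (-1) ^ (s + 1)`, where `s = m / (2 t)` and `t` is the least positive integer
with `k ∣ p ^ t + 1`. -/
noncomputable def semiprimitiveSign (k p m : ℕ) : ℂ :=
  (-1) ^ (m / (2 * semiprimitiveExponent k p) + 1)

/-- `λ₁ = (σ (k - 1) p ^ (m / 2) - 1) / k` (for even `m`). -/
noncomputable def semiprimitiveEig₁ (k p m : ℕ) : ℂ :=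
  (semiprimitiveSign k p m * ((k : ℂ) - 1) * (p : ℂ) ^ (m / 2) - 1) / (k : ℂ)

/-- `λ₂ = - (σ p ^ (m / 2) + 1) / k` (for even `m`). -/
noncomputable def semiprimitiveEig₂ (k p m : ℕ) : ℂ :=
  -((semiprimitiveSign k p m * (p : ℂ) ^ (m / 2) + 1) / (k : ℂ))

/-! The characters `x ↦ ψ (a * x)` diagonalise every Cayley graph on `F`, so the spectrum of the
graph is the family of Gaussian periods `η_a = ∑_{r ∈ R_k} ψ (a * r)`, and everything rests on
evaluating them.

Write `P = p ^ t`, `N = P + 1`, `q = P ^ (2 * s)`. For index `N`, `1 + N * η_a` is the Hermitian sum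
`∑ ψ (a * x ^ (P + 1))`. It is unchanged by `a ↦ -a`, so its square can be expanded by differencing;
for `ψ` Frobenius-invariant the cross terms become linear in `x ^ P`, and the square is `q` unless
`a` lies in one exceptional coset of `R_N` (`hermitianSum_sq`). The sign follows because `η_a` is an
algebraic integer and `(-P) ^ s ≡ 1` modulo `N` (`eq_of_sq_eq_of_isIntegral`). On the exceptional
coset the period is constant, and `∑ η_a = 0` gives its value. For `k ∣ N`, averaging the periods of
index `N` over `R_k` again yields two values, one of them on a single coset of `R_k`
(`exists_finset_charSum_powerSet_eq`).

The complement has the periods of the complementary connection set. The sum graph sends the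
character at `a` to `η_a` times the character at `-a`; in odd characteristic the combinations of
these two characters are eigenvectors for `±η_a`, and in characteristic two the sum graph is the
Cayley graph itself. -/

/-- A finite field with `p ^ m` elements has a nontrivial additive character that is invariant
under Frobenius. -/
theorem exists_frobenius_invariant_addChar {F : Type*} [Field F] [Fintype F] {p m : ℕ}
    (hp : p.Prime) (hF : Fintype.card F = p ^ m) :
    ∃ ψ : AddChar F ℂ, ψ.IsPrimitive ∧ ∀ x, ψ (x ^ p) = ψ x := by
  have : Fact p.Prime := ⟨hp⟩
  have : CharP F p := charP_of_card_eq_prime_pow hF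
  let : Algebra (ZMod p) F := ZMod.algebra F p
  let T := Algebra.trace (ZMod p) F
  have hTsum (x : F) : algebraMap (ZMod p) F (T x) = ∑ i ∈ Finset.range m, x ^ p ^ i := by
    have hfin : Module.finrank (ZMod p) F = m := by
      have h := Module.card_eq_pow_finrank (K := ZMod p) (V := F)
      rw [hF, ZMod.card] at h
      exact (Nat.pow_right_injective hp.two_le h).symm
    simpa [hfin] using FiniteField.algebraMap_trace_eq_sum_pow (ZMod p) F x
  have hinj := (algebraMap (ZMod p) F).injective
  -- The character is the standard one of the prime field composed with the absolute trace, which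
  -- Frobenius preserves.
  refine ⟨(ZMod.stdAddChar (N := p)).compAddMonoidHom T.toAddMonoidHom, ?_, ?_⟩
  · apply AddChar.IsPrimitive.of_ne_one
    intro h
    obtain ⟨x, hx⟩ := Algebra.trace_surjective (ZMod p) F 1
    have h1 := DFunLike.congr_fun h x
    have h2 : (ZMod.stdAddChar (N := p)) 1 = 1 := by
      rw [← hx]; exact h1
    rw [← AddChar.map_zero_eq_one (ZMod.stdAddChar (N := p))] at h2
    exact one_ne_zero (ZMod.injective_stdAddChar h2)
  · intro x
    have : T (x ^ p) = T x := by
      apply hinj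
      rw [hTsum, hTsum]
      -- Frobenius shifts the trace sum by one index; the two end terms agree because `x ^ p ^ m =
      -- x`.
      have h1 := Finset.sum_range_succ' (fun i => x ^ p ^ i) m
      rw [Finset.sum_range_succ] at h1
      have h2 : x ^ p ^ m = x := by rw [← hF]; exact FiniteField.pow_card x
      simp only [h2, pow_zero, pow_one] at h1
      rw [add_right_cancel h1]
      refine Finset.sum_congr rfl fun i _ => ?_
      rw [← pow_mul, pow_succ']
    change ZMod.stdAddChar (T (x ^ p)) = ZMod.stdAddChar (T x)
    rw [this]

/-- A matrix with an invertible matrix of eigenvectors has the expected multiset of eigenvalues. -/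
theorem Matrix.roots_charpoly_of_mul_eq_mul_diagonal {n K : Type*} [Fintype n] [DecidableEq n]
    [Field K] {A V : Matrix n n K} {d : n → K} (hV : IsUnit V.det)
    (h : A * V = V * Matrix.diagonal d) :
    A.charpoly.roots = Finset.univ.val.map d := by
  have hA : A = V * Matrix.diagonal d * V⁻¹ := by
    rw [← h, Matrix.mul_nonsing_inv_cancel_right _ _ hV]
  rw [hA, Matrix.charpoly_mul_comm, ← mul_assoc, Matrix.nonsing_inv_mul _ hV, one_mul,
    Matrix.charpoly_diagonal]
  exact (congrArg Polynomial.roots (by rw [Multiset.map_map]; rfl)).trans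
    (Polynomial.roots_multiset_prod_X_sub_C (Finset.univ.val.map d))

/-! ### Spectra of Cayley graphs and Cayley sum graphs through additive characters -/

section CayleySpectrum

variable {F : Type*} [Field F] [Fintype F]

open Classical in
/-- The eigenvalue of the Cayley graph of `S` at the character `x ↦ ψ (a * x)`. -/
noncomputable def charSum (ψ : AddChar F ℂ) (S : Set F) (a : F) : ℂ :=
  ∑ r : F, if r ∈ S then ψ (a * r) else 0

/-- Orthogonality of characters: the inverse is the conjugate transpose divided by `q`. -/
theorem isUnit_det_charMatrix [DecidableEq F] {ψ : AddChar F ℂ} (hψ : ψ.IsPrimitive) :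
    IsUnit (Matrix.of fun u a : F => ψ (u * a)).det := by
  apply Matrix.isUnit_det_of_right_inverse
    (B := Matrix.of fun a u : F => (Fintype.card F : ℂ)⁻¹ * ψ (-(a * u)))
  have hc : (Fintype.card F : ℂ) ≠ 0 := Nat.cast_ne_zero.mpr Fintype.card_ne_zero
  ext u v
  simp only [Matrix.mul_apply, Matrix.of_apply, Matrix.one_apply]
  have h : ∀ a : F, ψ (u * a) * ((Fintype.card F : ℂ)⁻¹ * ψ (-(a * v))) =
      (Fintype.card F : ℂ)⁻¹ * ψ (a * (u - v)) := fun a => by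
    rw [mul_left_comm, ← AddChar.map_add_eq_mul]; congr 2; ring
  rw [Finset.sum_congr rfl fun a _ => h a, ← Finset.mul_sum, AddChar.sum_mulShift _ hψ]
  simp only [sub_eq_zero]
  split_ifs <;> simp [hc]

theorem graphSpectrum_cayleyDigraph {ψ : AddChar F ℂ} (hψ : ψ.IsPrimitive) (S : Set F) :
    graphSpectrum (cayleyDigraph S) = Finset.univ.val.map (charSum ψ S) := by
  classical
  refine Matrix.roots_charpoly_of_mul_eq_mul_diagonal (isUnit_det_charMatrix hψ) ?_
  ext u a
  rw [Matrix.mul_diagonal, Matrix.mul_apply]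
  simp only [Matrix.of_apply, digraphAdjMatrix, cayleyDigraph, charSum, Finset.mul_sum]
  rw [← Equiv.sum_comp (Equiv.addLeft u)]
  refine Finset.sum_congr rfl fun r _ => ?_
  simp only [Equiv.coe_addLeft, add_sub_cancel_left]
  split_ifs
  · rw [one_mul, ← AddChar.map_add_eq_mul]; congr 1; ring
  · simp

theorem charSum_neg {ψ : AddChar F ℂ} {S : Set F} (hS : ∀ x, x ∈ S → -x ∈ S) (a : F) :
    charSum ψ S (-a) = charSum ψ S a := by
  classical
  unfold charSum
  rw [← Equiv.sum_comp (Equiv.neg F)]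
  refine Finset.sum_congr rfl fun r _ => ?_
  simp only [Equiv.neg_apply, neg_mul_neg]
  exact if_congr ⟨fun h => neg_neg r ▸ hS _ h, hS r⟩ rfl rfl

theorem charSum_zero (ψ : AddChar F ℂ) (S : Set F) : charSum ψ S 0 = S.ncard := by
  classical
  unfold charSum
  simp only [zero_mul, AddChar.map_zero_eq_one, Finset.sum_boole]
  rw [Set.ncard_eq_toFinset_card']
  congr 2
  ext; simp

/-- The spectrum of a Cayley sum graph with symmetric connection set, given a choice of sign on
each pair of opposite elements. -/
theorem graphSpectrum_cayleySumDigraph {ψ : AddChar F ℂ} (hψ : ψ.IsPrimitive) {S : Set F}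
    (hS : ∀ x, x ∈ S → -x ∈ S) (e : F → ℂ) (he0 : e 0 = 1) (he : ∀ a, e a = 1 ∨ e a = -1)
    (hneg : ∀ a, a ≠ 0 → e (-a) = - e a) :
    graphSpectrum (cayleySumDigraph S) = Finset.univ.val.map fun a => e a * charSum ψ S a := by
  classical
  let X : Matrix F F ℂ := Matrix.of fun u a : F => ψ (u * a)
  -- Column `a` of `X * T` is the character at `a` plus `e a` times the character at `-a`, the
  -- intended eigenvector for `e a * charSum ψ S a`. The sign rule makes the columns for `a` and
  -- `-a` independent; at `0` the column is twice the trivial character.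
  let T : Matrix F F ℂ := Matrix.of fun b a => (if b = a then 1 else 0) +
    e a * (if b = -a then 1 else 0)
  have hee (a : F) : e a * e a = 1 := by rcases he a with h | h <;> simp [h]
  have hXT (u a : F) : (X * T) u a = ψ (u * a) + e a * ψ (-(u * a)) := by
    simp only [X, T, Matrix.mul_apply, Matrix.of_apply, mul_add, Finset.sum_add_distrib]
    simp [mul_comm]
  have hT : IsUnit T.det := by
    have hTT : T.transpose * T = Matrix.diagonal fun a => if a = 0 then 4 else 2 := by
      ext a b
      simp only [T, Matrix.mul_apply, Matrix.transpose_apply, Matrix.of_apply,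
        Matrix.diagonal_apply, add_mul, Finset.sum_add_distrib, ite_mul, mul_ite, mul_one,
        mul_zero, zero_mul, one_mul, Finset.sum_ite_eq', Finset.mem_univ, if_true]
      by_cases hab : a = b
      · subst hab
        by_cases ha : a = 0
        · subst ha; norm_num [he0]
        -- A nonzero `a = -a` would give `e a = -e a`, impossible for a sign.
        · by_cases haa : a = -a
          · exfalso
            have h := hneg a ha
            rw [← haa] at h
            rcases he a with h1 | h1 <;> rw [h1] at h <;> norm_num at h
          · have haa' : -a ≠ a := fun h => haa h.symm
            simp [haa, haa', ha, hee]; norm_num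
      · by_cases hab' : a = -b
        · subst hab'
          have hb : b ≠ 0 := by rintro rfl; simp at hab
          have hb' : b ≠ -b := fun h => hab h.symm
          simp [hab, hb', hneg b hb]
        · have h2 : -a ≠ b := fun h => hab' (by rw [← h, neg_neg])
          simp [hab, hab', h2]
    have h := congrArg Matrix.det hTT
    rw [Matrix.det_mul, Matrix.det_transpose, Matrix.det_diagonal] at h
    rw [isUnit_iff_ne_zero]
    intro h0
    rw [h0, zero_mul] at h
    refine Finset.prod_ne_zero_iff.mpr (fun a _ => ?_) h.symm
    split_ifs <;> norm_num
  refine Matrix.roots_charpoly_of_mul_eq_mul_diagonal (V := X * T) ?_ ?_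
  · rw [Matrix.det_mul]
    exact (isUnit_det_charMatrix hψ).mul hT
  · ext u a
    rw [Matrix.mul_diagonal, Matrix.mul_apply]
    simp only [hXT]
    -- Substituting `v = r - u` shows that the adjacency matrix maps the character at `c` to a
    -- multiple of the one at `-c`.
    have h1 : ∀ c : F, ∑ v, digraphAdjMatrix (cayleySumDigraph S) u v * ψ (v * c) =
        charSum ψ S c * ψ (-(u * c)) := fun c => by
      rw [← Equiv.sum_comp (Equiv.addLeft (-u)), charSum, Finset.sum_mul]
      refine Finset.sum_congr rfl fun r _ => ?_
      simp only [Equiv.coe_addLeft, add_neg_cancel_left, digraphAdjMatrix, cayleySumDigraph,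
        Matrix.of_apply]
      split_ifs
      · rw [one_mul, ← AddChar.map_add_eq_mul]; congr 1; ring
      · simp
    have h2 := h1 (-a)
    simp only [mul_neg, neg_neg, charSum_neg hS] at h2
    simp only [mul_add, Finset.sum_add_distrib, mul_left_comm _ (e a), ← Finset.mul_sum, h1, h2]
    linear_combination (-(charSum ψ S a * ψ (-(u * a)))) * hee a

/-- A sign function on a group in which only `0` is its own negative. -/
theorem exists_sign_function (h2 : ∀ a : F, a = -a → a = 0) :
    ∃ e : F → ℂ, e 0 = 1 ∧ (∀ a, e a = 1 ∨ e a = -1) ∧ ∀ a, a ≠ 0 → e (-a) = - e a := by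
  let g := Fintype.equivFin F
  -- An arbitrary enumeration picks one element of each pair `{a, -a}`; the non-strict inequality
  -- gives `0` the sign `1`.
  refine ⟨fun a => if g a ≤ g (-a) then 1 else -1, by simp, fun a => ?_, fun a ha => ?_⟩
  · dsimp only; split_ifs <;> simp
  · have hne : g a ≠ g (-a) := fun h => ha (h2 a (g.injective h))
    simp only [neg_neg]
    rcases lt_or_gt_of_ne hne with h | h
    · rw [if_neg h.not_ge, if_pos h.le]
    · rw [if_pos h.le, if_neg h.not_ge, neg_neg]

end CayleySpectrum

/-! ### Nonzero `k`-th powers and their Gaussian periods -/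

section PowerSet

variable {F : Type*} [Field F] {k : ℕ}

theorem ne_zero_of_mem_powerSet {y : F} (hy : y ∈ powerSet F k) : y ≠ 0 := by
  obtain ⟨x, hx, rfl⟩ := hy
  exact pow_ne_zero k hx

theorem mul_mem_powerSet {y z : F} (hy : y ∈ powerSet F k) (hz : z ∈ powerSet F k) :
    y * z ∈ powerSet F k := by
  obtain ⟨x, hx, rfl⟩ := hy
  obtain ⟨w, hw, rfl⟩ := hz
  exact ⟨x * w, mul_ne_zero hx hw, mul_pow x w k⟩

theorem inv_mem_powerSet {y : F} (hy : y ∈ powerSet F k) : y⁻¹ ∈ powerSet F k := by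
  obtain ⟨x, hx, rfl⟩ := hy
  exact ⟨x⁻¹, inv_ne_zero hx, inv_pow x k⟩

theorem mul_mem_powerSet_iff {y z : F} (hy : y ∈ powerSet F k) :
    z * y ∈ powerSet F k ↔ z ∈ powerSet F k := by
  refine ⟨fun h => ?_, fun h => mul_mem_powerSet h hy⟩
  have := mul_mem_powerSet h (inv_mem_powerSet hy)
  rwa [mul_inv_cancel_right₀ (ne_zero_of_mem_powerSet hy)] at this

theorem powerSet_subset_of_dvd {N : ℕ} (h : k ∣ N) : powerSet F N ⊆ powerSet F k := by
  rintro _ ⟨x, hx, rfl⟩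
  obtain ⟨d, rfl⟩ := h
  exact ⟨x ^ d, pow_ne_zero d hx, by rw [← pow_mul, mul_comm]⟩

variable [Fintype F]

/-- In the cyclic group of order `k * d` with generator `g`, `(g ^ i) ^ d = 1` forces `k * d ∣ i *
d`, hence `k ∣ i`. -/
theorem mem_powerSet_of_pow_eq_one {d : ℕ} (h : Fintype.card F - 1 = k * d) {y : F}
    (hy : y ^ d = 1) : y ∈ powerSet F k := by
  have hpos : 0 < Fintype.card F - 1 := Nat.sub_pos_of_lt Fintype.one_lt_card
  have hd : 0 < d := Nat.pos_of_ne_zero (by rintro rfl; simp [h] at hpos)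
  have hy0 : y ≠ 0 := by rintro rfl; simp [hd.ne'] at hy
  classical
  obtain ⟨g, hg⟩ := IsCyclic.exists_generator (α := Fˣ)
  obtain ⟨i, hi⟩ := (mem_powers_iff_mem_zpowers (G := Fˣ)).mpr (hg (Units.mk0 y hy0))
  have ho : orderOf g = k * d := by
    rw [orderOf_eq_card_of_forall_mem_zpowers hg, Nat.card_eq_fintype_card, Fintype.card_units, h]
  have hi' : g ^ i = Units.mk0 y hy0 := hi
  have h1 : g ^ (i * d) = 1 := by
    rw [pow_mul, hi']; ext; simpa using hy
  have h2 := orderOf_dvd_of_pow_eq_one h1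
  rw [ho] at h2
  obtain ⟨j, rfl⟩ := Nat.dvd_of_mul_dvd_mul_right hd h2
  refine ⟨((g ^ j : Fˣ) : F), Units.ne_zero _, ?_⟩
  rw [← Units.val_pow_eq_pow_val, ← pow_mul, mul_comm, hi', Units.val_mk0]

theorem ncard_powerSet {d : ℕ} (h : Fintype.card F - 1 = k * d) : (powerSet F k).ncard = d := by
  classical
  have hpos : 0 < Fintype.card F - 1 := Nat.sub_pos_of_lt Fintype.one_lt_card
  have hk : 0 < k := Nat.pos_of_ne_zero (by rintro rfl; simp [h] at hpos)
  have him : powerSet F k = Units.val '' ((powMonoidHom k : Fˣ →* Fˣ).range : Set Fˣ) := by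
    ext y
    constructor
    · rintro ⟨x, hx, rfl⟩
      exact ⟨Units.mk0 x hx ^ k, ⟨Units.mk0 x hx, rfl⟩, by simp⟩
    · rintro ⟨_, ⟨u, rfl⟩, rfl⟩
      exact ⟨u, u.ne_zero, by simp⟩
  rw [him, Set.ncard_image_of_injective _ Units.val_injective, ← Nat.card_coe_set_eq]
  have := IsCyclic.card_powMonoidHom_range (G := Fˣ) k
  rw [Nat.card_eq_fintype_card (α := Fˣ), Fintype.card_units, h, Nat.gcd_mul_right_left,
    Nat.mul_div_cancel_left _ hk] at this
  exact this

open Classical in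
theorem card_filter_pow_eq {d : ℕ} (h : Fintype.card F - 1 = k * d) {y : F}
    (hy : y ∈ powerSet F k) : (Finset.univ.filter fun x : F => x ^ k = y).card = k := by
  have hpos : 0 < Fintype.card F - 1 := Nat.sub_pos_of_lt Fintype.one_lt_card
  have hk : 0 < k := Nat.pos_of_ne_zero (by rintro rfl; simp [h] at hpos)
  obtain ⟨x₀, hx₀, rfl⟩ := hy
  have hker := IsCyclic.card_powMonoidHom_ker (G := Fˣ) k
  rw [Nat.card_eq_fintype_card (α := Fˣ), Fintype.card_units, h, Nat.gcd_mul_right_left] at hker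
  have him : ((Finset.univ.filter fun x : F => x ^ k = x₀ ^ k : Finset F) : Set F) =
      (fun u : Fˣ => x₀ * u) '' ((powMonoidHom k : Fˣ →* Fˣ).ker : Set Fˣ) := by
    ext x
    simp only [Finset.coe_filter, Finset.mem_univ, true_and, Set.mem_ofPred_eq, Set.mem_image,
      SetLike.mem_coe, MonoidHom.mem_ker, powMonoidHom_apply]
    constructor
    · intro hx
      have hx0 : x ≠ 0 := by
        rintro rfl
        rw [zero_pow hk.ne'] at hx
        exact pow_ne_zero k hx₀ hx.symm
      refine ⟨Units.mk0 (x₀⁻¹ * x) (mul_ne_zero (inv_ne_zero hx₀) hx0), ?_, ?_⟩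
      · ext
        simp [mul_pow, hx, hx₀]
      · simp [hx₀]
    · rintro ⟨u, hu, rfl⟩
      rw [mul_pow, ← Units.val_pow_eq_pow_val, hu, Units.val_one, mul_one]
  rw [← Set.ncard_coe_finset, him, Set.ncard_image_of_injective, ← Nat.card_coe_set_eq]
  · exact hker
  · intro u v huv
    exact Units.ext (mul_left_cancel₀ hx₀ huv)

/-- Zero contributes `1`, and `x ↦ x ^ k` is `k`-to-one onto its nonzero values because `k` divides
`q - 1`. -/
theorem sum_mul_pow_eq {d : ℕ} (h : Fintype.card F - 1 = k * d) (ψ : AddChar F ℂ) (a : F) :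
    ∑ x : F, ψ (a * x ^ k) = 1 + k * charSum ψ (powerSet F k) a := by
  classical
  have hpos : 0 < Fintype.card F - 1 := Nat.sub_pos_of_lt Fintype.one_lt_card
  have hk : 0 < k := Nat.pos_of_ne_zero (by rintro rfl; simp [h] at hpos)
  have h1 : ∑ x : F, ψ (a * x ^ k) =
      ∑ y : F, ((if y = 0 then 1 else 0) + k * (if y ∈ powerSet F k then ψ (a * y) else 0)) := by
    rw [← Finset.sum_fiberwise (Finset.univ : Finset F) (fun x : F => x ^ k)]
    refine Finset.sum_congr rfl fun y _ => ?_
    rw [Finset.sum_congr rfl (g := fun _ => ψ (a * y))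
      fun x hx => by rw [(Finset.mem_filter.mp hx).2], Finset.sum_const, nsmul_eq_mul]
    by_cases hy : y = 0
    · subst hy
      have h0 : (0 : F) ∉ powerSet F k := fun h => ne_zero_of_mem_powerSet h rfl
      have h1 : (Finset.univ.filter fun x : F => x ^ k = 0) = {0} := by
        ext x; simp [pow_eq_zero_iff hk.ne']
      rw [h1]
      simp [h0]
    · by_cases hyR : y ∈ powerSet F k
      · rw [card_filter_pow_eq h hyR]
        simp [hy, hyR]
      · rw [Finset.filter_false_of_mem]
        · simp [hy, hyR]
        · rintro x - rfl
          refine hyR ⟨x, ?_, rfl⟩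
          rintro rfl
          exact hy (zero_pow hk.ne')
  rw [h1, Finset.sum_add_distrib, ← Finset.mul_sum, charSum]
  simp

theorem charSum_powerSet_mul (ψ : AddChar F ℂ) {r : F} (hr : r ∈ powerSet F k) (a : F) :
    charSum ψ (powerSet F k) (a * r) = charSum ψ (powerSet F k) a := by
  classical
  unfold charSum
  rw [← Equiv.sum_comp (Equiv.mulRight₀ r (ne_zero_of_mem_powerSet hr))
    fun x => if x ∈ powerSet F k then ψ (a * x) else 0]
  refine Finset.sum_congr rfl fun x _ => ?_
  change _ = if x * r ∈ powerSet F k then ψ (a * (x * r)) else 0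
  exact if_congr (mul_mem_powerSet_iff hr).symm (by congr 1; ring) rfl

theorem sum_charSum_powerSet {ψ : AddChar F ℂ} (hψ : ψ.IsPrimitive) :
    ∑ a, charSum ψ (powerSet F k) a = 0 := by
  classical
  unfold charSum
  rw [Finset.sum_comm]
  refine Finset.sum_eq_zero fun r _ => ?_
  split_ifs with hr
  · rw [AddChar.sum_mulShift r hψ, if_neg (ne_zero_of_mem_powerSet hr), Nat.cast_zero]
  · simp

/-- Character values are `q`-th roots of unity. Integrality is what later decides the sign of the
square root. -/
theorem isIntegral_charSum (ψ : AddChar F ℂ) (S : Set F) (a : F) :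
    IsIntegral ℤ (charSum ψ S a) := by
  classical
  refine IsIntegral.sum _ fun r _ => ?_
  split_ifs
  · refine IsIntegral.of_pow (n := Fintype.card F) Fintype.card_pos ?_
    rw [← AddChar.map_nsmul_eq_pow, card_nsmul_eq_zero, AddChar.map_zero_eq_one]
    exact isIntegral_one
  · exact isIntegral_zero

end PowerSet

/-! ### Arithmetic showing that `-1` is a `(P + 1)`-th and a `(P - 1)`-th power -/

theorem exists_pow_two_mul_sub_one_eq {P : ℕ} (hP : 2 ≤ P) (s : ℕ) :
    ∃ M, P ^ (2 * s) - 1 = (P + 1) * ((P - 1) * M) := by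
  obtain ⟨M, hM⟩ := Nat.sub_dvd_pow_sub_pow (P ^ 2) 1 s
  refine ⟨M, ?_⟩
  rw [pow_mul, ← one_pow s, hM, ← mul_assoc]
  congr 1
  obtain ⟨r, rfl⟩ := Nat.exists_eq_add_of_le' hP
  rw [one_pow]
  zify
  simp
  ring

theorem neg_one_pow_mul_eq_one {F : Type*} [Field F] {p t r : ℕ} [Fact p.Prime] [CharP F p]
    (hr : r = p ^ t - 1 ∨ r = p ^ t + 1) (M : ℕ) : (-1 : F) ^ (r * M) = 1 := by
  have hp : p.Prime := Fact.out
  rcases hp.eq_two_or_odd' with rfl | hodd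
  · rw [CharTwo.neg_eq, one_pow]
  · refine Even.neg_one_pow (Even.mul_right ?_ M)
    have : Odd (p ^ t) := hodd.pow
    rcases hr with rfl | rfl
    · exact Nat.Odd.sub_odd this odd_one
    · exact this.add_odd odd_one

/-! ### Hermitian sums and the periods of index `p ^ t + 1` -/

section HermitianSum

variable {F : Type*} [Field F] [Fintype F]

/-- The square of the Weil sum of a Hermitian-type monomial `a * x ^ (p ^ t + 1)`. -/
theorem hermitianSum_sq {p m t : ℕ} (hp : p.Prime) (hF : Fintype.card F = p ^ m)
    {ψ : AddChar F ℂ} (hψ : ψ.IsPrimitive) (hfrob : ∀ x, ψ (x ^ p) = ψ x)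
    (hneg : (-1 : F) ∈ powerSet F (p ^ t + 1)) {a : F}
    (hna : ∀ y : F, y ≠ 0 → (a * y ^ (p ^ t + 1)) ^ p ^ t ≠ -(a * y ^ (p ^ t + 1))) :
    (∑ x : F, ψ (a * x ^ (p ^ t + 1))) ^ 2 = Fintype.card F := by
  classical
  have : Fact p.Prime := ⟨hp⟩
  have : CharP F p := charP_of_card_eq_prime_pow hF
  have hfrobt : ∀ (t : ℕ) (x : F), ψ (x ^ p ^ t) = ψ x := fun t => by
    induction t with
    | zero => simp
    | succ t ih => intro x; rw [pow_succ, pow_mul, hfrob, ih]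
  obtain ⟨c, hc0, hc⟩ := hneg
  have hS : ∑ x : F, ψ (a * x ^ (p ^ t + 1)) = ∑ x : F, ψ (-(a * x ^ (p ^ t + 1))) := by
    rw [← Equiv.sum_comp (Equiv.mulLeft₀ c hc0)]
    refine Finset.sum_congr rfl fun x _ => ?_
    change ψ (a * (c * x) ^ (p ^ t + 1)) = _
    rw [mul_pow, hc]
    congr 1
    ring
  have hbij : Function.Bijective fun x : F => x ^ p ^ t := by
    rw [← Finite.injective_iff_bijective]
    exact iterateFrobenius_inj F p t
  -- In the expansion, the cross term `x * (a * y ^ P)` may be replaced under `ψ` by its `P`-th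
  -- power, so that both cross terms are linear in `x ^ P`.
  have hterm : ∀ x y : F, ψ (a * (x + y) ^ (p ^ t + 1)) * ψ (-(a * x ^ (p ^ t + 1))) =
      ψ (a * y ^ (p ^ t + 1)) * ψ (x ^ p ^ t * (a * y + (a * y ^ p ^ t) ^ p ^ t)) := by
    intro x y
    have h1 : ψ (x ^ p ^ t * (a * y + (a * y ^ p ^ t) ^ p ^ t)) =
        ψ (x ^ p ^ t * (a * y)) * ψ (x * (a * y ^ p ^ t)) := by
      rw [mul_add, AddChar.map_add_eq_mul, ← mul_pow, hfrobt]
    rw [h1, ← AddChar.map_add_eq_mul, ← AddChar.map_add_eq_mul, ← AddChar.map_add_eq_mul]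
    congr 1
    rw [pow_succ (x + y), add_pow_char_pow]
    ring
  have hinner : ∀ y : F, ∑ x : F, ψ (x ^ p ^ t * (a * y + (a * y ^ p ^ t) ^ p ^ t)) =
      if y = 0 then (Fintype.card F : ℂ) else 0 := by
    intro y
    rw [hbij.sum_comp fun z : F => ψ (z * (a * y + (a * y ^ p ^ t) ^ p ^ t)),
      AddChar.sum_mulShift _ hψ, Nat.cast_ite, Nat.cast_zero]
    refine if_congr ⟨fun h => ?_, ?_⟩ rfl rfl
    · by_contra hy
      apply hna y hy
      rw [eq_neg_iff_add_eq_zero, pow_succ, ← mul_assoc, mul_pow]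
      linear_combination (y ^ p ^ t) * h
    · rintro rfl
      simp [hp.ne_zero]
  rw [sq]
  conv_lhs => rw [mul_comm]; arg 1; rw [hS]
  rw [Finset.sum_mul_sum]
  have h2 : ∀ x : F, ∑ z : F, ψ (-(a * x ^ (p ^ t + 1))) * ψ (a * z ^ (p ^ t + 1)) =
      ∑ y : F, ψ (a * y ^ (p ^ t + 1)) * ψ (x ^ p ^ t * (a * y + (a * y ^ p ^ t) ^ p ^ t)) := by
    intro x
    rw [← Equiv.sum_comp (Equiv.addLeft x)]
    refine Finset.sum_congr rfl fun y _ => ?_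
    rw [Equiv.coe_addLeft, mul_comm, hterm]
  rw [Finset.sum_congr rfl fun x _ => h2 x, Finset.sum_comm]
  simp only [← Finset.mul_sum, hinner]
  simp

/-- If `η` is an algebraic integer and `1 + (P + 1) * η` is a square root of `P ^ (2 * s)`, then
its sign is determined by a congruence modulo `P + 1`. -/
theorem eq_of_sq_eq_of_isIntegral {P s : ℕ} (hP : 2 ≤ P) {η : ℂ} (hη : IsIntegral ℤ η)
    (h : (1 + (P + 1 : ℕ) * η) ^ 2 = (P : ℂ) ^ (2 * s)) :
    1 + (P + 1 : ℕ) * η = (-1) ^ s * (P : ℂ) ^ s := by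
  have hN : ((P + 1 : ℕ) : ℂ) ≠ 0 := Nat.cast_ne_zero.mpr P.succ_ne_zero
  -- Here `-P ≡ 1` modulo `P + 1`.
  have hcong : ((P + 1 : ℕ) : ℤ) ∣ (-1) ^ s * (P : ℤ) ^ s - 1 := by
    rw [← mul_pow]
    have := sub_dvd_pow_sub_pow (-1 * (P : ℤ)) 1 s
    rw [one_pow] at this
    refine dvd_trans ⟨-1, ?_⟩ this
    push_cast; ring
  obtain ⟨c, hc⟩ := hcong
  have hcC : (-1) ^ s * (P : ℂ) ^ s = 1 + (P + 1 : ℕ) * c := by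
    have : (((-1) ^ s * (P : ℤ) ^ s - 1 : ℤ) : ℂ) = (((P + 1 : ℕ) : ℤ) * c : ℤ) := by rw [hc]
    push_cast at this ⊢
    linear_combination this
  have hsq : (1 + (P + 1 : ℕ) * η) ^ 2 = ((-1) ^ s * (P : ℂ) ^ s) ^ 2 := by
    rw [h, mul_pow, ← pow_mul, ← pow_mul, mul_comm s 2, pow_mul (-1 : ℂ)]
    simp
  rcases sq_eq_sq_iff_eq_or_eq_neg.mp hsq with h1 | h1
  · exact h1
  · exfalso
    -- The wrong sign would make `η + c = -2 / (P + 1)` a rational algebraic integer, hence `P + 1 ∣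
    -- 2`, against `P ≥ 2`.
    have h2 : IsIntegral ℤ ((-(2 / (P + 1 : ℕ)) : ℚ) : ℂ) := by
      have : ((-(2 / (P + 1 : ℕ)) : ℚ) : ℂ) = η + (c : ℂ) := by
        rw [hcC] at h1
        push_cast at h1 hN ⊢
        field_simp
        linear_combination -h1
      rw [this]
      exact hη.add (isIntegral_algebraMap (R := ℤ) (A := ℂ) (x := c))
    have h3 : IsIntegral ℤ (-(2 / (P + 1 : ℕ)) : ℚ) :=
      (isIntegral_algebraMap_iff (A := ℚ) (B := ℂ) (algebraMap ℚ ℂ).injective).mp h2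
    obtain ⟨z, hz⟩ := IsIntegrallyClosed.isIntegral_iff.mp h3
    have hNQ : ((P + 1 : ℕ) : ℚ) ≠ 0 := Nat.cast_ne_zero.mpr P.succ_ne_zero
    have h4 : (z * (P + 1 : ℕ) : ℤ) = -2 := by
      have : (z : ℚ) * (P + 1 : ℕ) = -2 := by
        rw [show (z : ℚ) = -(2 / (P + 1 : ℕ)) from hz]
        field_simp
      exact_mod_cast this
    have h5 : ((P + 1 : ℕ) : ℤ) ∣ 2 := ⟨-z, by linear_combination h4⟩
    have h6 := Int.le_of_dvd two_pos h5
    push_cast at h6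
    omega

variable {p m t s : ℕ}

theorem neg_one_mem_powerSet (hp : p.Prime) (ht : 0 < t) (hm : m = 2 * t * s)
    (hF : Fintype.card F = p ^ m) : (-1 : F) ∈ powerSet F (p ^ t + 1) := by
  have : Fact p.Prime := ⟨hp⟩
  have : CharP F p := charP_of_card_eq_prime_pow hF
  have hP : 2 ≤ p ^ t := hp.two_le.trans (Nat.le_self_pow ht.ne' p)
  have hF' : Fintype.card F = (p ^ t) ^ (2 * s) := hF.trans (by rw [← pow_mul, hm]; congr 1; ring)
  obtain ⟨M, hM⟩ := exists_pow_two_mul_sub_one_eq hP s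
  rw [← hF'] at hM
  exact mem_powerSet_of_pow_eq_one hM (neg_one_pow_mul_eq_one (t := t) (by simp) M)

/-- The Gaussian periods for the index `p ^ t + 1`. -/
theorem exists_charSum_powerSet_eq (hp : p.Prime) (ht : 0 < t) (hm : m = 2 * t * s)
    (hF : Fintype.card F = p ^ m)
    {ψ : AddChar F ℂ} (hψ : ψ.IsPrimitive) (hfrob : ∀ x, ψ (x ^ p) = ψ x) :
    ∃ b : F, b ≠ 0 ∧ ∀ a : F, a ≠ 0 →
      (a * b⁻¹ ∈ powerSet F (p ^ t + 1) → charSum ψ (powerSet F (p ^ t + 1)) a =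
        ((-1) ^ s * (p : ℂ) ^ (t * s) - 1) / (p ^ t + 1 : ℕ) - (-1) ^ s * (p : ℂ) ^ (t * s)) ∧
      (a * b⁻¹ ∉ powerSet F (p ^ t + 1) → charSum ψ (powerSet F (p ^ t + 1)) a =
        ((-1) ^ s * (p : ℂ) ^ (t * s) - 1) / (p ^ t + 1 : ℕ)) := by
  classical
  have : Fact p.Prime := ⟨hp⟩
  have : CharP F p := charP_of_card_eq_prime_pow hF
  have hP : 2 ≤ p ^ t := hp.two_le.trans (Nat.le_self_pow ht.ne' p)
  have hF' : Fintype.card F = (p ^ t) ^ (2 * s) := hF.trans (by rw [← pow_mul, hm]; congr 1; ring)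
  obtain ⟨M, hM⟩ := exists_pow_two_mul_sub_one_eq hP s
  rw [← hF'] at hM
  have hM' : Fintype.card F - 1 = (p ^ t - 1) * ((p ^ t + 1) * M) := by rw [hM]; ring
  have hneg := neg_one_mem_powerSet hp ht hm hF
  -- With `b ^ (P - 1) = -1`, a nonzero `w` with `w ^ P = -w` has `(w / b) ^ (P - 1) = 1`, so `w /
  -- b` is a `(P + 1)`-th power: the exceptional coset is `b * R_N`.
  obtain ⟨b, hb0, hb⟩ : (-1 : F) ∈ powerSet F (p ^ t - 1) :=
    mem_powerSet_of_pow_eq_one hM' (neg_one_pow_mul_eq_one (t := t) (by simp) M)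
  have hN : ((p ^ t + 1 : ℕ) : ℂ) ≠ 0 := Nat.cast_ne_zero.mpr (Nat.succ_ne_zero _)
  set A : ℂ := ((-1) ^ s * (p : ℂ) ^ (t * s) - 1) / (p ^ t + 1 : ℕ) with hA
  have hout : ∀ a : F, a ≠ 0 → a * b⁻¹ ∉ powerSet F (p ^ t + 1) →
      charSum ψ (powerSet F (p ^ t + 1)) a = A := by
    intro a ha hab
    have hsq := hermitianSum_sq hp hF hψ hfrob hneg (a := a) (t := t) fun y hy hz => by
      apply hab
      rw [← mul_mem_powerSet_iff (⟨y, hy, rfl⟩ : y ^ (p ^ t + 1) ∈ powerSet F (p ^ t + 1))]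
      apply mem_powerSet_of_pow_eq_one hM
      rw [pow_mul]
      have hw0 : a * y ^ (p ^ t + 1) ≠ 0 := mul_ne_zero ha (pow_ne_zero _ hy)
      have hw : (a * y ^ (p ^ t + 1)) ^ (p ^ t - 1) = -1 := by
        apply mul_right_cancel₀ hw0
        rw [← pow_succ, Nat.sub_add_cancel (by omega), hz, neg_one_mul]
      rw [mul_right_comm, mul_pow, hw, inv_pow, hb]
      simp
    rw [sum_mul_pow_eq hM, hF', Nat.cast_pow] at hsq
    have := eq_of_sq_eq_of_isIntegral hP (isIntegral_charSum ψ _ a) hsq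
    rw [hA, eq_div_iff hN, pow_mul]
    push_cast at this ⊢
    linear_combination this
  refine ⟨b, hb0, fun a ha => ⟨fun hab => ?_, hout a ha⟩⟩
  have hconst : ∀ c : F, c * b⁻¹ ∈ powerSet F (p ^ t + 1) →
      charSum ψ (powerSet F (p ^ t + 1)) c = charSum ψ (powerSet F (p ^ t + 1)) b := by
    intro c hc
    rw [← charSum_powerSet_mul ψ hc b, mul_comm c, mul_inv_cancel_left₀ hb0]
  rw [hconst a hab]
  set d := (p ^ t - 1) * M with hd
  have hd0 : (d : ℂ) ≠ 0 := by
    have : 0 < Fintype.card F - 1 := Nat.sub_pos_of_lt Fintype.one_lt_card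
    rw [hM] at this
    exact Nat.cast_ne_zero.mpr (Nat.pos_of_mul_pos_left this).ne'
  -- The periods over all `a` sum to zero: `d` at `a = 0`, the unknown value `d` times on the
  -- exceptional coset, and `A` elsewhere.
  have hsum := sum_charSum_powerSet (k := p ^ t + 1) hψ
  have hval : ∀ c : F, charSum ψ (powerSet F (p ^ t + 1)) c =
      A + (if c = 0 then d - A else 0) +
        (if c * b⁻¹ ∈ powerSet F (p ^ t + 1) then
          charSum ψ (powerSet F (p ^ t + 1)) b - A else 0) := by
    intro c
    by_cases hc : c = 0
    · subst hc
      have h0 : (0 : F) ∉ powerSet F (p ^ t + 1) := fun h => ne_zero_of_mem_powerSet h rfl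
      rw [charSum_zero, ncard_powerSet hM]
      simp [h0]
    · by_cases hcb : c * b⁻¹ ∈ powerSet F (p ^ t + 1)
      · rw [hconst c hcb]; simp [hc, hcb]
      · rw [hout c hc hcb]; simp [hc, hcb]
  have hcount : ((Finset.univ.filter fun c : F => c * b⁻¹ ∈ powerSet F (p ^ t + 1)).card : ℂ)
      = d := by
    rw [← ncard_powerSet hM, ← Set.ncard_coe_finset]
    congr 1
    refine Set.ncard_congr (fun c _ => c * b⁻¹) (fun c hc => by simpa using hc)
      (fun c c' _ _ h => mul_right_cancel₀ (inv_ne_zero hb0) h) fun c hc => ⟨c * b, ?_, ?_⟩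
    · simpa [hb0] using hc
    · simp [hb0]
  rw [Finset.sum_congr rfl fun c _ => hval c] at hsum
  simp only [Finset.sum_add_distrib, Finset.sum_ite_eq', Finset.mem_univ, if_true,
    Finset.sum_const, nsmul_eq_mul] at hsum
  rw [← Finset.sum_filter, Finset.sum_const, nsmul_eq_mul, hcount, Finset.card_univ] at hsum
  have hcard : (Fintype.card F : ℂ) = 1 + (p ^ t + 1 : ℕ) * d := by
    have h1 : Fintype.card F = 1 + (p ^ t + 1) * d := by
      have := Fintype.card_pos (α := F)
      omega
    rw [h1]; push_cast; ring
  rw [hcard] at hsum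
  have hNA : ((p ^ t + 1 : ℕ) : ℂ) * A = (-1) ^ s * (p : ℂ) ^ (t * s) - 1 := by
    rw [hA]; field_simp
  apply mul_left_cancel₀ hd0
  linear_combination hsum - (d : ℂ) * hNA

end HermitianSum

/-! ### Descent from index `p ^ t + 1` to a divisor `k` -/

section Period

variable {F : Type*} [Field F] [Fintype F] {p m t s k : ℕ}

-- Multiplication by `u ∈ R_N ⊆ R_k` permutes `R_k`; summing over the `d` elements `u` and
-- exchanging the sums gives the identity.
open Classical in
theorem charSum_powerSet_average (ψ : AddChar F ℂ) {N d : ℕ} (hkN : k ∣ N)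
    (hd : Fintype.card F - 1 = N * d) (a : F) :
    d * charSum ψ (powerSet F k) a =
      ∑ r : F with r ∈ powerSet F k, charSum ψ (powerSet F N) (a * r) := by
  have hsum (K : ℕ) (c : F) :
      charSum ψ (powerSet F K) c = ∑ r : F with r ∈ powerSet F K, ψ (c * r) := by
    rw [charSum, Finset.sum_filter]
  simp only [hsum N]
  rw [Finset.sum_comm]
  have h1 : ∀ u ∈ Finset.univ.filter (· ∈ powerSet F N),
      (∑ r : F with r ∈ powerSet F k, ψ (a * r * u)) = charSum ψ (powerSet F k) a := by
    intro u hu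
    have hu' := (Finset.mem_filter.mp hu).2
    rw [← charSum_powerSet_mul ψ (powerSet_subset_of_dvd hkN hu') a, hsum]
    exact Finset.sum_congr rfl fun r _ => by congr 1; ring
  rw [Finset.sum_congr rfl h1, Finset.sum_const, nsmul_eq_mul]
  congr 2
  rw [← ncard_powerSet hd, ← Set.ncard_coe_finset]
  congr 1
  ext; simp

/-- The semiprimitive Gaussian periods: the nonzero elements of `F` split into a symmetric set of
`n = (q - 1) / k` elements and its complement, with one eigenvalue on each. -/
theorem exists_finset_charSum_powerSet_eq (hp : p.Prime) (ht : 0 < t) (hm : m = 2 * t * s)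
    (hF : Fintype.card F = p ^ m) (hk : k ∣ p ^ t + 1) {n : ℕ} (hn : Fintype.card F - 1 = k * n)
    {ψ : AddChar F ℂ} (hψ : ψ.IsPrimitive) (hfrob : ∀ x, ψ (x ^ p) = ψ x) :
    ∃ E : Finset F, 0 ∉ E ∧ E.card = n ∧ (∀ a, a ∈ E → -a ∈ E) ∧
      (∀ a ∈ E, charSum ψ (powerSet F k) a =
        ((-1) ^ s * (p : ℂ) ^ (t * s) - 1) / k - (-1) ^ s * (p : ℂ) ^ (t * s)) ∧
      ∀ a, a ≠ 0 → a ∉ E → charSum ψ (powerSet F k) a =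
        ((-1) ^ s * (p : ℂ) ^ (t * s) - 1) / k := by
  classical
  obtain ⟨b, hb0, hb⟩ := exists_charSum_powerSet_eq hp ht hm hF hψ hfrob
  have hP : 2 ≤ p ^ t := hp.two_le.trans (Nat.le_self_pow ht.ne' p)
  have hF' : Fintype.card F = (p ^ t) ^ (2 * s) := hF.trans (by rw [← pow_mul, hm]; congr 1; ring)
  obtain ⟨M, hM⟩ := exists_pow_two_mul_sub_one_eq hP s
  rw [← hF'] at hM
  set d := (p ^ t - 1) * M with hd
  have hpos : 0 < Fintype.card F - 1 := Nat.sub_pos_of_lt Fintype.one_lt_card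
  have hd0 : (d : ℂ) ≠ 0 := by
    rw [hM] at hpos
    exact Nat.cast_ne_zero.mpr (Nat.pos_of_mul_pos_left hpos).ne'
  have hk0 : (k : ℂ) ≠ 0 := by
    rw [hn] at hpos
    exact Nat.cast_ne_zero.mpr (Nat.pos_of_mul_pos_right hpos).ne'
  have hN : ((p ^ t + 1 : ℕ) : ℂ) ≠ 0 := Nat.cast_ne_zero.mpr (Nat.succ_ne_zero _)
  have hsub := powerSet_subset_of_dvd (F := F) hk
  have hneg := hsub (neg_one_mem_powerSet hp ht hm hF)
  have hcardk : ((Finset.univ.filter (· ∈ powerSet F k)).card : ℂ) = n := by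
    rw [← ncard_powerSet hn, ← Set.ncard_coe_finset]
    congr 2
    ext; simp
  set Q : ℂ := (-1) ^ s * (p : ℂ) ^ (t * s) with hQ
  -- Each `r ∈ R_k` contributes the generic period of index `N`, less `Q` when `a * r` falls in the
  -- exceptional coset `b * R_N`.
  have hsum : ∀ a : F, a ≠ 0 → d * charSum ψ (powerSet F k) a =
      n * ((Q - 1) / (p ^ t + 1 : ℕ)) -
        (Finset.univ.filter fun r => r ∈ powerSet F k ∧ a * r * b⁻¹ ∈ powerSet F (p ^ t + 1)).card
          * Q := by
    intro a ha
    rw [charSum_powerSet_average ψ hk hM a, ← hcardk]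
    have : ∀ r ∈ Finset.univ.filter (· ∈ powerSet F k),
        charSum ψ (powerSet F (p ^ t + 1)) (a * r) = (Q - 1) / (p ^ t + 1 : ℕ) -
          if a * r * b⁻¹ ∈ powerSet F (p ^ t + 1) then Q else 0 := by
      intro r hr
      have hr0 := ne_zero_of_mem_powerSet (Finset.mem_filter.mp hr).2
      obtain ⟨h1, h2⟩ := hb (a * r) (mul_ne_zero ha hr0)
      split_ifs with h
      · exact h1 h
      · rw [h2 h, sub_zero]
    rw [Finset.sum_congr rfl this, Finset.sum_sub_distrib, Finset.sum_const, nsmul_eq_mul,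
      ← Finset.sum_filter, Finset.sum_const, nsmul_eq_mul, Finset.filter_filter]
  have hnd : (k : ℂ) * n = (p ^ t + 1 : ℕ) * d := by
    exact_mod_cast hn.symm.trans hM
  have hratio : (n : ℂ) * ((Q - 1) / (p ^ t + 1 : ℕ)) = d * ((Q - 1) / k) := by
    field_simp
    linear_combination (Q - 1) * hnd
  -- The special set is the coset `b * R_k`; since `R_N ⊆ R_k`, only its elements `a` have an `a *
  -- r` with `r ∈ R_k` in `b * R_N`.
  refine ⟨Finset.univ.filter fun a => a * b⁻¹ ∈ powerSet F k, ?_, ?_, ?_, ?_, ?_⟩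
  · intro h
    exact ne_zero_of_mem_powerSet (Finset.mem_filter.mp h).2 (zero_mul _)
  · rw [← ncard_powerSet hn, ← Set.ncard_coe_finset]
    refine Set.ncard_congr (fun c _ => c * b⁻¹) (fun c hc => by simpa using hc)
      (fun c c' _ _ h => mul_right_cancel₀ (inv_ne_zero hb0) h) fun c hc => ⟨c * b, ?_, ?_⟩
    · simpa [hb0] using hc
    · simp [hb0]
  · intro a ha
    rw [Finset.mem_filter] at ha ⊢
    refine ⟨Finset.mem_univ _, ?_⟩
    have := mul_mem_powerSet ha.2 hneg
    rwa [mul_neg_one, ← neg_mul] at this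
  · intro a ha
    have hab := (Finset.mem_filter.mp ha).2
    have ha0 : a ≠ 0 := by
      rintro rfl
      exact ne_zero_of_mem_powerSet hab (zero_mul _)
    have hcount : (Finset.univ.filter fun r => r ∈ powerSet F k ∧
        a * r * b⁻¹ ∈ powerSet F (p ^ t + 1)).card = d := by
      rw [← ncard_powerSet hM, ← Set.ncard_coe_finset]
      have hab0 := ne_zero_of_mem_powerSet hab
      have hr (r : F) : a * r * b⁻¹ = r * (a * b⁻¹) := by ring
      refine Set.ncard_congr (fun r _ => r * (a * b⁻¹)) (fun r hr' => ?_)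
        (fun c c' _ _ h => mul_right_cancel₀ hab0 h) fun c hc => ⟨c * (a * b⁻¹)⁻¹, ?_, ?_⟩
      · rw [← hr]
        simp only [Finset.coe_filter, Finset.mem_univ, true_and] at hr'
        exact hr'.2
      · simp only [Finset.coe_filter, Finset.mem_univ, true_and]
        refine ⟨mul_mem_powerSet (hsub hc) (inv_mem_powerSet hab), ?_⟩
        rwa [hr, inv_mul_cancel_right₀ hab0]
      · exact inv_mul_cancel_right₀ hab0 c
    have h := hsum a ha0
    rw [hcount, hratio] at h
    apply mul_left_cancel₀ hd0
    linear_combination h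
  · intro a ha0 ha
    have hcount : (Finset.univ.filter fun r => r ∈ powerSet F k ∧
        a * r * b⁻¹ ∈ powerSet F (p ^ t + 1)) = ∅ := by
      refine Finset.filter_false_of_mem fun r _ ⟨h1, h2⟩ => ha ?_
      rw [Finset.mem_filter]
      refine ⟨Finset.mem_univ _, (mul_mem_powerSet_iff h1).mp ?_⟩
      rw [mul_right_comm]
      exact hsub h2
    have h := hsum a ha0
    rw [hcount, hratio] at h
    apply mul_left_cancel₀ hd0
    rw [h]; simp

end Period

/-! ### Arithmetic of semiprimitive pairs -/

section Parameters

/-- Let `u` be the least exponent and `r = t % u`, supposed nonzero. Modulo `k`, `p ^ r` is `-1` or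
`1`; in the second case `p ^ (u - r) = -1`. Either way minimality of `u` fails. -/
theorem semiprimitiveExponent_dvd {k p t : ℕ} (ht : 0 < t) (hk : k ∣ p ^ t + 1) :
    0 < semiprimitiveExponent k p ∧ k ∣ p ^ semiprimitiveExponent k p + 1 ∧
      semiprimitiveExponent k p ∣ t := by
  have hne : {t : ℕ | 0 < t ∧ k ∣ p ^ t + 1}.Nonempty := ⟨t, ht, hk⟩
  obtain ⟨h0, h1⟩ := Nat.sInf_mem hne
  have hmin : ∀ r, 0 < r → k ∣ p ^ r + 1 → semiprimitiveExponent k p ≤ r :=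
    fun r hr hr' => Nat.sInf_le ⟨hr, hr'⟩
  change 0 < semiprimitiveExponent k p at h0
  change k ∣ p ^ semiprimitiveExponent k p + 1 at h1
  refine ⟨h0, h1, ?_⟩
  generalize semiprimitiveExponent k p = u at *
  have cast (r : ℕ) : k ∣ p ^ r + 1 ↔ (p : ZMod k) ^ r = -1 := by
    rw [← ZMod.natCast_eq_zero_iff, ← add_eq_zero_iff_eq_neg]; push_cast; rfl
  rw [cast] at h1 hk
  rw [← Nat.div_add_mod t u, pow_add, pow_mul, h1] at hk
  have hlt := Nat.mod_lt t h0
  by_contra hdvd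
  have hr : 0 < t % u := Nat.pos_of_ne_zero fun h => hdvd (Nat.dvd_of_mod_eq_zero h)
  rcases neg_one_pow_eq_or (ZMod k) (t / u) with h | h
  · rw [h, one_mul, ← cast] at hk
    exact absurd (hmin _ hr hk) (by omega)
  · rw [h, neg_one_mul, neg_inj] at hk
    have h2 : (p : ZMod k) ^ (u - t % u) = -1 := by
      rw [← h1, ← mul_one (_ ^ (u - t % u)), ← hk, ← pow_add, Nat.sub_add_cancel hlt.le]
    rw [← cast] at h2
    exact absurd (hmin _ (by omega) h2) (by omega)

/-- Both kinds of pair take one shape: for `k = 2` the congruence modulo `4` makes `p` odd, so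
exponent `1` works. The least exponent divides every admissible one, hence `m / 2`. -/
theorem IsSemiprimitivePair.exists_parameters {k p m : ℕ} (hp : p.Prime) (hm : Even m)
    (hm0 : m ≠ 0) (h : IsSemiprimitivePair k p m) :
    2 ≤ k ∧ 0 < semiprimitiveExponent k p ∧ k ∣ p ^ semiprimitiveExponent k p + 1 ∧
      k ≠ p ^ (m / 2) + 1 ∧ ∃ s, 0 < s ∧ m = 2 * semiprimitiveExponent k p * s := by
  obtain ⟨r, hr⟩ := hm
  have hr2 : m / 2 = r := by omega
  have hr0 : 0 < r := by omega
  obtain ⟨hk, t, ht0, ht, hkt, hne⟩ : 2 ≤ k ∧ ∃ t, 0 < t ∧ t ∣ r ∧ k ∣ p ^ t + 1 ∧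
      k ≠ p ^ (m / 2) + 1 := by
    rcases h with ⟨rfl, h4⟩ | ⟨hk, ⟨t, -, ht, hkt⟩, hne⟩
    · have hodd : Odd p := by
        rcases hp.eq_two_or_odd' with rfl | hodd
        · exfalso
          have : 2 ∣ 2 ^ m := dvd_pow_self 2 hm0
          unfold Nat.ModEq at h4
          omega
        · exact hodd
      refine ⟨le_rfl, 1, one_pos, one_dvd _, ?_, ?_⟩
      · rw [pow_one]; exact (hodd.add_odd odd_one).two_dvd
      · have : 2 ≤ p ^ (m / 2) := hp.two_le.trans (Nat.le_self_pow (by omega) p)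
        omega
    · rw [hr2] at ht
      exact ⟨hk.le, t, Nat.pos_of_dvd_of_pos ht hr0, ht, hkt, hne⟩
  obtain ⟨h1, h2, h3⟩ := semiprimitiveExponent_dvd ht0 hkt
  obtain ⟨s, hs⟩ := h3.trans ht
  refine ⟨hk, h1, h2, hne, s, Nat.pos_of_ne_zero ?_, ?_⟩
  · rintro rfl; omega
  · rw [hr, hs]; ring

end Parameters

/-! ### Spectra as multisets, and the complement -/

theorem HasGraphSpectrum.isIntegralGraph {V : Type*} [Fintype V] {D : Digraph V}
    {L : List (ℂ × ℕ)} (h : HasGraphSpectrum D L) (hL : ∀ x ∈ L, ∃ a : ℤ, x.1 = a) :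
    IsIntegralGraph D := by
  intro z hz
  rw [h.2] at hz
  clear h
  induction L with
  | nil => simp at hz
  | cons x L ih =>
    rw [List.map_cons, List.sum_cons, Multiset.mem_add] at hz
    rcases hz with hz | hz
    · rw [Multiset.eq_of_mem_replicate hz]
      exact hL x (by simp)
    · exact ih (fun y hy => hL y (List.mem_cons_of_mem x hy)) hz

section Multisets

variable {F : Type*} [Field F] [Fintype F]

theorem Finset.map_val_eq_replicate {α β : Type*} {E : Finset α} {d : α → β} {l : β}
    (h : ∀ a ∈ E, d a = l) : E.val.map d = Multiset.replicate E.card l := by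
  rw [Multiset.map_congr rfl h, Multiset.map_const']
  rfl

theorem map_univ_val_eq [DecidableEq F] (d : F → ℂ) {E : Finset F} (h0 : 0 ∉ E) :
    Finset.univ.val.map d =
      {d 0} + (E.val.map d + (Finset.univ.erase 0 \ E).val.map d) := by
  have hsub : E ⊆ Finset.univ.erase 0 := fun a ha =>
    Finset.mem_erase.mpr ⟨by rintro rfl; exact h0 ha, Finset.mem_univ _⟩
  have h1 : (Finset.univ : Finset F).val = {0} + (E.val + (Finset.univ.erase 0 \ E).val) := by
    rw [Finset.sdiff_val, add_tsub_cancel_of_le (Finset.val_le_iff.mpr hsub), Finset.erase_val,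
      Multiset.singleton_add, Multiset.cons_erase (Finset.mem_univ_val 0)]
  rw [h1, Multiset.map_add, Multiset.map_add, Multiset.map_singleton]

/-- Negation exchanges the elements of sign `1` and `-1` in `E`, so each sign occurs on exactly half
of `E`. -/
theorem map_sign_mul_eq {F : Type*} [Field F] {e : F → ℂ} (he : ∀ a, e a = 1 ∨ e a = -1)
    (hneg : ∀ a, a ≠ 0 → e (-a) = - e a) {E : Finset F} (h0 : 0 ∉ E)
    (hE : ∀ a ∈ E, -a ∈ E) {f : F → ℂ} {l : ℂ} (hf : ∀ a ∈ E, f a = l) :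
    E.val.map (fun a => e a * f a) =
      Multiset.replicate (E.card / 2) l + Multiset.replicate (E.card / 2) (-l) := by
  classical
  have hE0 : ∀ a ∈ E, a ≠ 0 := by rintro a ha rfl; exact h0 ha
  have hcard : (E.filter fun a => e a = 1).card = (E.filter fun a => ¬ e a = 1).card := by
    refine Finset.card_nbij' (fun a => -a) (fun a => -a) ?_ ?_ ?_ ?_
    · intro a ha
      have ha := Finset.mem_filter.mp ha
      refine Finset.mem_filter.mpr ⟨hE a ha.1, ?_⟩
      rw [hneg a (hE0 a ha.1), ha.2]; norm_num
    · intro a ha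
      have ha := Finset.mem_filter.mp ha
      refine Finset.mem_filter.mpr ⟨hE a ha.1, ?_⟩
      rw [hneg a (hE0 a ha.1), (he a).resolve_left ha.2]; norm_num
    · intro a _; simp
    · intro a _; simp
  have htot := Finset.card_filter_add_card_filter_not (s := E) (fun a => e a = 1)
  have hsplit : E.val = (E.filter fun a => e a = 1).val + (E.filter fun a => ¬ e a = 1).val := by
    rw [Finset.filter_val, Finset.filter_val, Multiset.filter_add_not]
  rw [hsplit, Multiset.map_add, Finset.map_val_eq_replicate (l := l),
    Finset.map_val_eq_replicate (l := -l)]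
  · congr 2 <;> omega
  · intro a ha
    have ha := Finset.mem_filter.mp ha
    rw [(he a).resolve_left ha.2, hf a ha.1]; ring
  · intro a ha
    have ha := Finset.mem_filter.mp ha
    rw [ha.2, hf a ha.1, one_mul]

theorem looplessCompl_paleyGraph {F : Type*} [Field F] (k : ℕ) :
    looplessCompl (paleyGraph F k) = cayleyDigraph {x | x ≠ 0 ∧ x ∉ powerSet F k} := by
  ext u v
  change (u ≠ v ∧ ¬ (v - u ∈ powerSet F k)) ↔ (v - u ≠ 0 ∧ v - u ∉ powerSet F k)
  rw [sub_ne_zero, ne_comm]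

/-- The connection set is `F` minus `{0}` minus `R_k`, and the full character sum is `q` at `a = 0`
and `0` otherwise. -/
theorem charSum_compl {ψ : AddChar F ℂ} (hψ : ψ.IsPrimitive) (k : ℕ) [DecidableEq F] (a : F) :
    charSum ψ {x | x ≠ 0 ∧ x ∉ powerSet F k} a =
      (if a = 0 then (Fintype.card F : ℂ) else 0) - 1 - charSum ψ (powerSet F k) a := by
  classical
  have h1 := AddChar.sum_mulShift a hψ
  rw [Nat.cast_ite, Nat.cast_zero] at h1
  have h2 : (1 : ℂ) = ∑ r : F, if r = 0 then ψ (r * a) else 0 := by simp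
  rw [← h1]
  nth_rw 1 [h2]
  unfold charSum
  rw [← Finset.sum_sub_distrib, ← Finset.sum_sub_distrib]
  refine Finset.sum_congr rfl fun r _ => ?_
  by_cases hr : r = 0
  · subst hr
    have h0 : (0 : F) ∉ powerSet F k := fun h => ne_zero_of_mem_powerSet h rfl
    simp [h0]
  · by_cases hrk : r ∈ powerSet F k <;> simp [hr, hrk, mul_comm]

end Multisets

/-! ### Distinctness of the eigenvalues, with `Q = p ^ (m / 2)`, `e = (-1) ^ s`, `L = λ₂` and `L - e
* Q = λ₁` -/

section Arithmetic

variable {k n Q L e : ℤ}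

/-- The three eigenvalues of a semiprimitive graph are distinct. -/
theorem semiprimitive_eigenvalues_nodup (hk : 2 ≤ k) (hQ : 2 ≤ Q) (hn : k * n = Q ^ 2 - 1)
    (hL : k * L = e * Q - 1) (he : e = 1 ∨ e = -1) (hkQ : k ≠ Q + 1) :
    n ≠ L - e * Q ∧ n ≠ L ∧ L - e * Q ≠ L := by
  have he0 : e ≠ 0 := by rcases he with rfl | rfl <;> norm_num
  have hQ0 : Q ≠ 0 := by omega
  refine ⟨fun h => ?_, fun h => ?_, fun h => mul_ne_zero he0 hQ0 (by linarith)⟩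
  -- Equality would force `Q = e * (1 - k)`, so `e = -1` and `k = Q + 1`: exactly the excluded case.
  · have : Q * (Q - e * (1 - k)) = 0 := by rw [h] at hn; linear_combination hL - hn
    have := (mul_eq_zero.mp this).resolve_left hQ0
    rcases he with rfl | rfl <;> omega
  · have : Q * (Q - e) = 0 := by rw [h] at hn; linear_combination hL - hn
    have := (mul_eq_zero.mp this).resolve_left hQ0
    rcases he with rfl | rfl <;> omega

theorem semiprimitive_eigenvalues_compl_nodup (hk : 2 ≤ k) (hQ : 2 ≤ Q) (hn : k * n = Q ^ 2 - 1)
    (hL : k * L = e * Q - 1) (he : e = 1 ∨ e = -1) :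
    (k - 1) * n ≠ (k - 1) * L ∧ (k - 1) * n ≠ -1 - L ∧ (k - 1) * L ≠ -1 - L := by
  have he0 : e ≠ 0 := by rcases he with rfl | rfl <;> norm_num
  have hQ0 : Q ≠ 0 := by omega
  refine ⟨fun h => ?_, fun h => ?_, fun h => mul_ne_zero he0 hQ0 (by linarith)⟩
  · have h := mul_left_cancel₀ (by omega : k - 1 ≠ 0) h
    have : Q * (Q - e) = 0 := by rw [h] at hn; linear_combination hL - hn
    have := (mul_eq_zero.mp this).resolve_left hQ0
    rcases he with rfl | rfl <;> omega
  · have : Q * (Q * (k - 1) + e) = 0 := by linear_combination k * h - hL - (k - 1) * hn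
    have := (mul_eq_zero.mp this).resolve_left hQ0
    rcases he with rfl | rfl <;> nlinarith

/-- After multiplication by `k`, each coincidence up to sign becomes `Q * x = 2`, impossible for `Q
≥ 3`. -/
theorem semiprimitive_eigenvalues_sum_nodup (hQ : 3 ≤ Q) (hn : k * n = Q ^ 2 - 1)
    (hL : k * L = e * Q - 1) :
    n ≠ -(L - e * Q) ∧ n ≠ -L ∧ L - e * Q ≠ -(L - e * Q) ∧ L ≠ -L ∧ L - e * Q ≠ -L := by
  have h2 : ∀ x, Q * x ≠ 2 := fun x h => by
    have := Int.le_of_dvd two_pos ⟨x, h.symm⟩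
    omega
  refine ⟨fun h => h2 (Q + e * (1 - k)) ?_, fun h => h2 (Q + e) ?_,
    fun h => h2 (2 * e * (1 - k)) ?_, fun h => h2 (2 * e) ?_, fun h => h2 (e * (2 - k)) ?_⟩
  · rw [h] at hn; linear_combination -hn - hL
  · rw [h] at hn; linear_combination -hn - hL
  · linear_combination k * h - 2 * hL
  · linear_combination k * h - 2 * hL
  · linear_combination k * h - 2 * hL

end Arithmetic

/-! ### Assembly of the three spectra -/

theorem theorem5p3 (k p m n : ℕ) (l₁ l₂ : ℂ) (hp : p.Prime) (hm : Even m)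
    (hk : IsSemiprimitivePair k p m)
    (F : Type*) [Field F] [Fintype F] (hF : Fintype.card F = p ^ m)
    (hn : n = (p ^ m - 1) / k)
    (hl₁ : l₁ = semiprimitiveEig₁ k p m) (hl₂ : l₂ = semiprimitiveEig₂ k p m) :
    -- the three spectra are integral
    (IsIntegralGraph (paleyGraph F k) ∧ IsIntegralGraph (paleySumGraph F k) ∧
      IsIntegralGraph (looplessCompl (paleyGraph F k))) ∧
    -- the spectrum of the graph
    HasGraphSpectrum (paleyGraph F k) [((n : ℂ), 1), (l₁, n), (l₂, (k - 1) * n)] ∧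
    -- the spectrum of its complement
    HasGraphSpectrum (looplessCompl (paleyGraph F k))
      [(((k : ℂ) - 1) * n, 1), (((k : ℂ) - 1) * l₂, n), (-1 - l₂, (k - 1) * n)] ∧
    -- the spectrum of the sum graph, in even characteristic
    (Even (p ^ m) → graphSpectrum (paleySumGraph F k) = graphSpectrum (paleyGraph F k)) ∧
    -- the spectrum of the sum graph, in odd characteristic, where all multiplicities are integers
    (Odd (p ^ m) → Even n ∧
      HasGraphSpectrum (paleySumGraph F k)
        [((n : ℂ), 1), (l₁, n / 2), (-l₁, n / 2),
          (l₂, (k - 1) * n / 2), (-l₂, (k - 1) * n / 2)]) := by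
  classical
  have : Fact p.Prime := ⟨hp⟩
  have : CharP F p := charP_of_card_eq_prime_pow hF
  have hm0 : m ≠ 0 := by
    rintro rfl
    have := Fintype.one_lt_card (α := F)
    rw [hF, pow_zero] at this
    omega
  obtain ⟨hk2, ht, hkt, hkne, s, hs0, hms⟩ := hk.exists_parameters hp hm hm0
  have hm2 : m / 2 = semiprimitiveExponent k p * s := by
    rw [hms, mul_assoc]; exact Nat.mul_div_cancel_left _ two_pos
  -- The periods are expressed through `(-1) ^ s = -σ`; hence `λ₂ = ((-1) ^ s * Q - 1) / k` and `λ₁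
  -- = λ₂ - (-1) ^ s * Q` with `Q = p ^ (t * s)`.
  have hsign : semiprimitiveSign k p m = -(-1) ^ s := by
    have h1 : m / (2 * semiprimitiveExponent k p) = s := by
      nth_rw 1 [hms]
      exact Nat.mul_div_cancel_left _ (by omega)
    rw [semiprimitiveSign, h1, pow_succ, mul_neg_one]
  unfold semiprimitiveEig₁ at hl₁
  unfold semiprimitiveEig₂ at hl₂
  rw [hsign, hm2] at hl₁ hl₂
  rw [hm2] at hkne
  clear hsign hm2 hk
  generalize semiprimitiveExponent k p = t at *
  have hP : 2 ≤ p ^ t := hp.two_le.trans (Nat.le_self_pow ht.ne' p)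
  have hQ : 2 ≤ p ^ (t * s) := hp.two_le.trans (Nat.le_self_pow (by positivity) p)
  have hq : p ^ m = (p ^ (t * s)) ^ 2 := by rw [← pow_mul, hms]; congr 1; ring
  -- `n` and divisibility by `k`
  obtain ⟨M, hM⟩ := exists_pow_two_mul_sub_one_eq hP s
  have hqP : p ^ m = (p ^ t) ^ (2 * s) := by rw [← pow_mul, hms]; congr 1; ring
  rw [← hqP] at hM
  obtain ⟨c, hc⟩ := hkt
  have hnc : n = c * ((p ^ t - 1) * M) := by
    rw [hn, hM, hc, mul_assoc, Nat.mul_div_cancel_left _ (by omega)]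
  have hkn : p ^ m - 1 = k * n := by rw [hM, hc, hnc, mul_assoc]
  have hkn1 : p ^ m = k * n + 1 := by
    have : 0 < p ^ m := pow_pos hp.pos m
    omega
  -- integrality
  obtain ⟨L, hL⟩ : (k : ℤ) ∣ (-1) ^ s * (p ^ (t * s) : ℕ) - 1 := by
    -- As `k ∣ p ^ t + 1`, `-p ^ t ≡ 1` modulo `k`, and so is its `s`-th power.
    have h1 := sub_dvd_pow_sub_pow (-1 * ((p ^ t : ℕ) : ℤ)) 1 s
    rw [one_pow, mul_pow, ← Nat.cast_pow, ← pow_mul] at h1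
    refine dvd_trans ⟨-c, ?_⟩ h1
    have : ((p ^ t : ℕ) : ℤ) + 1 = k * c := by exact_mod_cast hc
    linear_combination -this
  have he : ((-1 : ℤ) ^ s = 1 ∨ (-1 : ℤ) ^ s = -1) := neg_one_pow_eq_or ℤ s
  have hk0 : (k : ℂ) ≠ 0 := Nat.cast_ne_zero.mpr (by omega)
  have hLC : (k : ℂ) * L = (-1) ^ s * (p : ℂ) ^ (t * s) - 1 := by
    have : ((k * L : ℤ) : ℂ) = ((-1) ^ s * (p ^ (t * s) : ℕ) - 1 : ℤ) := by rw [hL]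
    push_cast at this
    exact this
  have hl₂' : l₂ = (L : ℂ) := by
    rw [hl₂, ← mul_right_inj' hk0, hLC]
    field_simp
    ring
  have hl₁' : l₁ = ((L - (-1) ^ s * (p ^ (t * s) : ℕ) : ℤ) : ℂ) := by
    rw [hl₁, ← mul_right_inj' hk0]
    push_cast
    rw [mul_sub (k : ℂ), hLC]
    field_simp
    ring
  have hLdiv : ((-1) ^ s * (p : ℂ) ^ (t * s) - 1) / k = L := by
    rw [← hLC]; field_simp
  have hknZ : (k : ℤ) * n = ((p ^ (t * s) : ℕ) : ℤ) ^ 2 - 1 := by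
    have : ((p ^ (t * s)) ^ 2 : ℕ) = k * n + 1 := by rw [← hq, hkn1]
    have : (((p ^ (t * s)) ^ 2 : ℕ) : ℤ) = k * n + 1 := by rw [this]; push_cast; ring
    push_cast at this ⊢
    linear_combination -this
  have hQZ : (2 : ℤ) ≤ (p ^ (t * s) : ℕ) := by exact_mod_cast hQ
  have hk2Z : (2 : ℤ) ≤ k := by exact_mod_cast hk2
  have hkneZ : (k : ℤ) ≠ (p ^ (t * s) : ℕ) + 1 := by exact_mod_cast hkne
  -- the eigenvalues
  obtain ⟨ψ, hψ, hfrob⟩ := exists_frobenius_invariant_addChar hp hF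
  have hcard : Fintype.card F - 1 = k * n := by rw [hF, hkn]
  obtain ⟨E, hE0, hEcard, hEneg, hE₁, hE₂⟩ :=
    exists_finset_charSum_powerSet_eq hp ht hms hF ⟨c, hc⟩ hcard hψ hfrob
  have hE₁' : ∀ a ∈ E, charSum ψ (powerSet F k) a = l₁ := by
    intro a ha
    rw [hE₁ a ha, hLdiv, hl₁']; push_cast; rfl
  have hE₂' : ∀ a ∈ Finset.univ.erase 0 \ E, charSum ψ (powerSet F k) a = l₂ := by
    intro a ha
    simp only [Finset.mem_sdiff, Finset.mem_erase, Finset.mem_univ, and_true] at ha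
    rw [hE₂ a ha.1 ha.2, hLdiv, hl₂']
  have hcard₂ : (Finset.univ.erase 0 \ E).card = (k - 1) * n := by
    have hsub : E ⊆ Finset.univ.erase 0 := fun a ha =>
      Finset.mem_erase.mpr ⟨by rintro rfl; exact hE0 ha, Finset.mem_univ _⟩
    rw [Finset.card_sdiff_of_subset hsub, Finset.card_erase_of_mem (Finset.mem_univ _),
      Finset.card_univ, hcard, hEcard, Nat.sub_mul, one_mul]
  have hzero : charSum ψ (powerSet F k) 0 = n := by rw [charSum_zero, ncard_powerSet hcard]
  have hneg1 : (-1 : F) ∈ powerSet F k :=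
    powerSet_subset_of_dvd ⟨c, hc⟩ (neg_one_mem_powerSet hp ht hms hF)
  have hsymm : ∀ x, x ∈ powerSet F k → -x ∈ powerSet F k := fun x hx => by
    rw [← mul_neg_one]; exact mul_mem_powerSet hx hneg1
  -- the spectrum of the graph
  obtain ⟨hd1, hd2, hd3⟩ := semiprimitive_eigenvalues_nodup hk2Z hQZ hknZ hL.symm he hkneZ
  have hspec : HasGraphSpectrum (paleyGraph F k) [((n : ℂ), 1), (l₁, n), (l₂, (k - 1) * n)] := by
    constructor
    · have h1 : (n : ℂ) ≠ l₁ := by rw [hl₁']; exact_mod_cast hd1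
      have h2 : (n : ℂ) ≠ l₂ := by rw [hl₂']; exact_mod_cast hd2
      have h3 : l₁ ≠ l₂ := by rw [hl₁', hl₂']; exact_mod_cast hd3
      simp [h1, h2, h3]
    · rw [paleyGraph, graphSpectrum_cayleyDigraph hψ, map_univ_val_eq _ hE0,
        Finset.map_val_eq_replicate hE₁', Finset.map_val_eq_replicate hE₂', hcard₂, hEcard, hzero]
      simp
  -- the spectrum of the complement
  have hcompl : HasGraphSpectrum (looplessCompl (paleyGraph F k))
      [(((k : ℂ) - 1) * n, 1), (((k : ℂ) - 1) * l₂, n), (-1 - l₂, (k - 1) * n)] := by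
    constructor
    · obtain ⟨hd1, hd2, hd3⟩ := semiprimitive_eigenvalues_compl_nodup hk2Z hQZ hknZ hL.symm he
      have h1 : ((k : ℂ) - 1) * n ≠ ((k : ℂ) - 1) * l₂ := by rw [hl₂']; exact_mod_cast hd1
      have h2 : ((k : ℂ) - 1) * n ≠ -1 - l₂ := by rw [hl₂']; exact_mod_cast hd2
      have h3 : ((k : ℂ) - 1) * l₂ ≠ -1 - l₂ := by rw [hl₂']; exact_mod_cast hd3
      simp only [List.map_cons, List.map_nil, List.nodup_cons, List.mem_cons, List.not_mem_nil,
        or_false, not_or, not_false_eq_true, List.nodup_nil, and_true]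
      exact ⟨⟨h1, h2⟩, h3⟩
    · have hv0 : charSum ψ {x | x ≠ 0 ∧ x ∉ powerSet F k} 0 = ((k : ℂ) - 1) * n := by
        rw [charSum_compl hψ, if_pos rfl, hzero, hF, hkn1]; push_cast; ring
      have hv1 : ∀ a ∈ E, charSum ψ {x | x ≠ 0 ∧ x ∉ powerSet F k} a = ((k : ℂ) - 1) * l₂ := by
        intro a ha
        -- The value is `-1 - λ₁`, which equals `(k - 1) * λ₂` because `k * λ₂ = (-1) ^ s * Q - 1`.
        rw [charSum_compl hψ, if_neg (by rintro rfl; exact hE0 ha), hE₁' a ha, hl₁', hl₂']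
        push_cast
        linear_combination -hLC
      have hv2 : ∀ a ∈ Finset.univ.erase 0 \ E,
          charSum ψ {x | x ≠ 0 ∧ x ∉ powerSet F k} a = -1 - l₂ := by
        intro a ha
        rw [charSum_compl hψ, hE₂' a ha, if_neg, zero_sub]
        exact Finset.ne_of_mem_erase (Finset.mem_sdiff.mp ha).1
      rw [looplessCompl_paleyGraph, graphSpectrum_cayleyDigraph hψ, map_univ_val_eq _ hE0,
        Finset.map_val_eq_replicate hv1, Finset.map_val_eq_replicate hv2, hcard₂, hEcard, hv0]
      simp
  -- the spectrum of the sum graph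
  have heven : Even (p ^ m) →
      graphSpectrum (paleySumGraph F k) = graphSpectrum (paleyGraph F k) := by
    intro h
    obtain rfl : p = 2 := by
      rcases hp.eq_two_or_odd' with h2 | hodd
      · exact h2
      · exact absurd h (Nat.not_even_iff_odd.mpr hodd.pow)
    congr 1
    ext u v
    change u + v ∈ powerSet F k ↔ v - u ∈ powerSet F k
    rw [CharTwo.sub_eq_add, add_comm]
  have hodd : Odd (p ^ m) → Even n ∧ HasGraphSpectrum (paleySumGraph F k)
      [((n : ℂ), 1), (l₁, n / 2), (-l₁, n / 2),
        (l₂, (k - 1) * n / 2), (-l₂, (k - 1) * n / 2)] := by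
    intro h
    have hpodd : Odd p := by
      rcases hp.eq_two_or_odd' with rfl | h2
      · exact absurd h (Nat.not_odd_iff_even.mpr (even_two.pow_of_ne_zero hm0))
      · exact h2
    have hp2 : p ≠ 2 := by rintro rfl; exact absurd hpodd (by decide)
    refine ⟨?_, ?_, ?_⟩
    · rw [hnc]
      exact Even.mul_left (Even.mul_right (Nat.Odd.sub_odd hpodd.pow odd_one) M) c
    · have hQ3 : (3 : ℤ) ≤ (p ^ (t * s) : ℕ) := by
        have h1 : 3 ≤ p := by have := hp.two_le; omega
        exact_mod_cast h1.trans (Nat.le_self_pow (by positivity) p)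
      obtain ⟨hs1, hs2, hs3, hs4, hs5⟩ := semiprimitive_eigenvalues_sum_nodup hQ3 hknZ hL.symm
      have h1 : (n : ℂ) ≠ l₁ := by rw [hl₁']; exact_mod_cast hd1
      have h2 : (n : ℂ) ≠ l₂ := by rw [hl₂']; exact_mod_cast hd2
      have h3 : l₁ ≠ l₂ := by rw [hl₁', hl₂']; exact_mod_cast hd3
      have h4 : (n : ℂ) ≠ -l₁ := by rw [hl₁']; exact_mod_cast hs1
      have h5 : (n : ℂ) ≠ -l₂ := by rw [hl₂']; exact_mod_cast hs2
      have h6 : l₁ ≠ -l₁ := by rw [hl₁']; exact_mod_cast hs3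
      have h7 : l₂ ≠ -l₂ := by rw [hl₂']; exact_mod_cast hs4
      have h8 : l₁ ≠ -l₂ := by rw [hl₁', hl₂']; exact_mod_cast hs5
      have h9 : -l₁ ≠ l₂ := fun h => h8 (by rw [← h, neg_neg])
      have h10 : -l₁ ≠ -l₂ := fun h => h3 (neg_inj.mp h)
      simp only [List.map_cons, List.map_nil, List.nodup_cons, List.mem_cons, List.not_mem_nil,
        or_false, not_or, not_false_eq_true, List.nodup_nil, and_true]
      exact ⟨⟨h1, h4, h2, h5⟩, ⟨h6, h3, h8⟩, ⟨h9, h10⟩, h7⟩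
    · have hself : ∀ a : F, a = -a → a = 0 := fun a ha => by
        have h2 : (2 : F) ≠ 0 := Ring.two_ne_zero (by rwa [ringChar.eq F p])
        have : (2 : F) * a = 0 := by linear_combination ha
        exact (mul_eq_zero.mp this).resolve_left h2
      obtain ⟨e, he0, he1, heneg⟩ := exists_sign_function hself
      have h0' : (0 : F) ∉ Finset.univ.erase 0 \ E := by simp
      have hE'neg : ∀ a ∈ Finset.univ.erase 0 \ E, -a ∈ Finset.univ.erase 0 \ E := by
        intro a ha
        simp only [Finset.mem_sdiff, Finset.mem_erase, Finset.mem_univ, and_true] at ha ⊢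
        exact ⟨neg_ne_zero.mpr ha.1, fun h => ha.2 (neg_neg a ▸ hEneg _ h)⟩
      rw [paleySumGraph, graphSpectrum_cayleySumDigraph hψ hsymm e he0 he1 heneg,
        map_univ_val_eq _ hE0, map_sign_mul_eq he1 heneg hE0 hEneg hE₁',
        map_sign_mul_eq he1 heneg h0' hE'neg hE₂', hcard₂, hEcard, hzero, he0]
      simp [add_assoc]
  have hint : IsIntegralGraph (paleyGraph F k) := by
    refine hspec.isIntegralGraph ?_
    simp only [List.forall_mem_cons, List.not_mem_nil, false_imp_iff, implies_true, and_true]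
    exact ⟨⟨n, by simp⟩, ⟨_, hl₁'⟩, ⟨_, hl₂'⟩⟩
  refine ⟨⟨hint, ?_, hcompl.isIntegralGraph ?_⟩, hspec, hcompl, heven, hodd⟩
  · rcases Nat.even_or_odd (p ^ m) with h | h
    · unfold IsIntegralGraph
      rw [heven h]
      exact hint
    · refine (hodd h).2.isIntegralGraph ?_
      simp only [List.forall_mem_cons, List.not_mem_nil, false_imp_iff, implies_true, and_true]
      refine ⟨⟨n, by simp⟩, ⟨_, hl₁'⟩, ⟨-(L - (-1) ^ s * (p ^ (t * s) : ℕ)), ?_⟩, ⟨_, hl₂'⟩,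
        ⟨-L, ?_⟩⟩
      · exact (congrArg Neg.neg hl₁').trans (Int.cast_neg _).symm
      · exact (congrArg Neg.neg hl₂').trans (Int.cast_neg _).symm
  · simp only [List.forall_mem_cons, List.not_mem_nil, false_imp_iff, implies_true, and_true]
    rw [hl₂']
    exact ⟨⟨(k - 1) * n, by push_cast; rfl⟩, ⟨(k - 1) * L, by push_cast; rfl⟩,
      ⟨-1 - L, by push_cast; rfl⟩⟩
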